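/- Let $(\Theta,d)$ be a complete separable metric space with its Borel $\sigma$-algebra and let $\Pi$ be a probability measure on $\Theta$. For finite measures $\mu,\nu$ on $\Theta$ let $$w(\mu,\nu)=\sup_{\psi}\Big|\int\psi\,d\mu-\int\psi\,d\nu\Big|,$$ where the supremum is over all $\psi:\Theta\to\mathbf{R}$ with $|\psi(s)-\psi(t)|\le d(s,t)$ and $|\psi(s)|\le 1$ for all $s,t\in\Theta$ (the bounded Lipschitz distance). A Monte Carlo procedure on $\Theta$ is a pair $\mathcal{M}=(M,e)$, where $M$ is a probability measure on $\Theta^{\{0,1,2,\ldots\}}$ (with the product $\sigma$-algebra) and $e=(e_m)_{m\ge1}$, each $e_m$ being a measurable map from $\Theta^m$ to the finite measures on $\Theta$. It is called consistent to $\Pi$ if $$R_m(\mathcal{M},\Pi)=\int w\big(e_m(\theta(0),\ldots,\theta(m-1)),\Pi\big)\,M(d\theta)\longrightarrow 0\qquad(m\to\infty).$$ Then: 1. (Crude Monte Carlo.) If $M=\Pi^{\otimes\{0,1,2,\ldots\}}$ and $e_m=\frac1m\sum_{i=0}^{m-1}\delta_{\theta(i)}$, then $(M,e)$ is consistent to $\Pi$.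 2. (Importance sampling.) If $Q$ is a probability measure on $\Theta$ with $\Pi\ll Q$, $M=Q^{\otimes\{0,1,2,\ldots\}}$ and $e_m=\frac1m\sum_{i=0}^{m-1}\frac{d\Pi}{dQ}(\theta(i))\,\delta_{\theta(i)}$, where $\frac{d\Pi}{dQ}$ is a finite-valued version of the density, then $(M,e)$ is consistent to $\Pi$. 3. Let $T(\theta(0),\theta(1),\ldots)=(\theta(1),\theta(2),\ldots)$. If $M$ is stationary ($M(T^{-1}A)=M(A)$ for every measurable $A$) and ergodic ($M(A)\in\{0,1\}$ for every measurable $A$ with $T^{-1}A=A$), if $\theta(0)$ has law $\Pi$ under $M$, and if $e_m=\frac1m\sum_{i=0}^{m-1}\delta_{\theta(i)}$ for all $m\ge1$, then $(M,e)$ is consistent to $\Pi$. -/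

import Mathlib

open MeasureTheory ProbabilityTheory Filter Topology
open scoped NNReal ENNReal

namespace MonteCarlo

/-- The bounded Lipschitz unit ball `BL₁`: functions with `|ψ s - ψ t| ≤ d(s, t)` and `|ψ| ≤ 1`. -/
def BL₁ (Θ : Type*) [MetricSpace Θ] : Set (Θ → ℝ) :=
  {ψ | (∀ s t, |ψ s - ψ t| ≤ dist s t) ∧ ∀ s, |ψ s| ≤ 1}

/-- The bounded Lipschitz distance `w(μ, ν) = sup_{ψ ∈ BL₁} |∫ ψ dμ - ∫ ψ dν|`. It is only used
for finite measures `μ`, `ν`, and every `ψ ∈ BL₁` is then integrable. -/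
noncomputable def blDist {Θ : Type*} [MetricSpace Θ] [MeasurableSpace Θ] (μ ν : Measure Θ) :
    ℝ≥0∞ :=
  ⨆ ψ ∈ BL₁ Θ, ENNReal.ofReal |∫ x, ψ x ∂μ - ∫ x, ψ x ∂ν|

/-- A non-random Monte Carlo procedure `(M, e)` on `(S, Θ)`: a probability measure `M` on the
sequences in `S` and, for each sample size `m`, an estimator `e m`, a measurable map from `S^m`
to finite measures on `Θ`. The measures `e m s` are not required to have mass one, since those of
importance sampling do not. -/
structure Procedure (S Θ : Type*) [MeasurableSpace S] [MeasurableSpace Θ] where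
  M : Measure (ℕ → S)
  prob : IsProbabilityMeasure M
  e : (m : ℕ) → Kernel (Fin m → S) Θ
  finite : ∀ m s, IsFiniteMeasure (e m s)

/-- The initial segment `(s(0), …, s(m-1))` of a sequence. -/
def initial {S : Type*} (m : ℕ) (s : ℕ → S) : Fin m → S := fun i => s i

/-- The shift `(s(0), s(1), …) ↦ (s(1), s(2), …)`. -/
def shift {S : Type*} (s : ℕ → S) : ℕ → S := fun i => s (i + 1)

namespace Procedure

/-- The risk `R_m = ∫ w(e_m(s), Π) M(ds)`. -/
noncomputable def risk {S Θ : Type*} [MeasurableSpace S] [MetricSpace Θ] [MeasurableSpace Θ]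
    (P : Procedure S Θ) (Pi : Measure Θ) (m : ℕ) : ℝ≥0∞ :=
  ∫⁻ s, blDist (P.e m (initial m s)) Pi ∂P.M

/-- Consistency: `R_m → 0` as `m → ∞`. -/
def IsConsistent {S Θ : Type*} [MeasurableSpace S] [MetricSpace Θ] [MeasurableSpace Θ]
    (P : Procedure S Θ) (Pi : Measure Θ) : Prop :=
  Tendsto (fun m => P.risk Pi m) atTop (𝓝 0)

/-- Stationarity: `M(T⁻¹ A) = M(A)` for the shift `T`. -/
def IsStationary {S Θ : Type*} [MeasurableSpace S] [MeasurableSpace Θ]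
    (P : Procedure S Θ) : Prop :=
  MeasurePreserving shift P.M P.M

/-- Ergodicity: every measurable `A` with `T⁻¹ A = A` is null or co-null, i.e. `M(A) = 0` or `1`. -/
def IsErgodic {S Θ : Type*} [MeasurableSpace S] [MeasurableSpace Θ]
    (P : Procedure S Θ) : Prop :=
  PreErgodic shift P.M

/-- The law of the coordinate `s(0)`; for a stationary procedure this is its invariant law. -/
noncomputable def invariantLaw {S Θ : Type*} [MeasurableSpace S] [MeasurableSpace Θ]
    (P : Procedure S Θ) : Measure S :=
  P.M.map (fun s => s 0)

end Procedure

/-- The weighted empirical measures `(1/m) ∑_{i<m} g(θ(i)) δ_{θ(i)}`. -/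
noncomputable def weightedEmpirical {Θ : Type*} [MeasurableSpace Θ] (g : Θ → ℝ≥0)
    (hg : Measurable g) (m : ℕ) : Kernel (Fin m → Θ) Θ where
  toFun θ := (m : ℝ≥0)⁻¹ • ∑ i, g (θ i) • Measure.dirac (θ i)
  measurable' := by
    refine Measure.measurable_of_measurable_coe _ fun A hA => ?_
    simp only [Measure.smul_apply, Measure.finsetSum_apply, Measure.dirac_apply' _ hA,
      ENNReal.smul_def, smul_eq_mul]
    refine Measurable.const_mul (Finset.measurable_sum _ fun i _ => ?_) _
    exact (hg.comp (measurable_pi_apply i)).coe_nnreal_ennreal.mul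
      ((measurable_one.indicator hA).comp (measurable_pi_apply i))

/-- The empirical measures `(1/m) ∑_{i<m} δ_{θ(i)}`. -/
noncomputable def empirical {Θ : Type*} [MeasurableSpace Θ] (m : ℕ) : Kernel (Fin m → Θ) Θ where
  toFun θ := (m : ℝ≥0)⁻¹ • ∑ i, Measure.dirac (θ i)
  measurable' := by
    refine Measure.measurable_of_measurable_coe _ fun A hA => ?_
    simp only [Measure.smul_apply, Measure.finsetSum_apply, Measure.dirac_apply' _ hA,
      ENNReal.smul_def, smul_eq_mul]
    refine Measurable.const_mul (Finset.measurable_sum _ fun i _ => ?_) _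
    exact (measurable_one.indicator hA).comp (measurable_pi_apply i)

/-- Crude Monte Carlo: independent draws from `Pi` and the empirical distribution. -/
noncomputable def crude {Θ : Type*} [MeasurableSpace Θ] (Pi : Measure Θ)
    [IsProbabilityMeasure Pi] : Procedure Θ Θ where
  M := Measure.infinitePi fun _ : ℕ => Pi
  prob := inferInstance
  e := empirical
  finite m θ := by
    change IsFiniteMeasure ((m : ℝ≥0)⁻¹ • ∑ i, Measure.dirac (θ i))
    infer_instance

/-- Importance sampling: independent draws from `Q` and the empirical distribution weighted with
the Radon-Nikodym derivative `dPi/dQ`, which is `Q`-almost everywhere finite. -/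
noncomputable def importance {Θ : Type*} [MeasurableSpace Θ] (Pi Q : Measure Θ)
    [IsProbabilityMeasure Q] : Procedure Θ Θ where
  M := Measure.infinitePi fun _ : ℕ => Q
  prob := inferInstance
  e := weightedEmpirical (fun θ => (Pi.rnDeriv Q θ).toNNReal)
    (Measure.measurable_rnDeriv Pi Q).ennreal_toNNReal
  finite m θ := by
    change IsFiniteMeasure
      ((m : ℝ≥0)⁻¹ • ∑ i, (Pi.rnDeriv Q (θ i)).toNNReal • Measure.dirac (θ i))
    infer_instance

/-- The integrand `s ↦ w(e_m(s), Pi)` of the risk is measurable, so that the Lebesgue integral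
in `Procedure.risk` is the genuine one. -/
theorem measurable_blDist {S Θ : Type*} [MeasurableSpace S] [MetricSpace Θ]
    [TopologicalSpace.SeparableSpace Θ] [MeasurableSpace Θ] [BorelSpace Θ]
    (P : Procedure S Θ) (Pi : Measure Θ) [IsFiniteMeasure Pi] (m : ℕ) :
    Measurable fun s : ℕ → S => blDist (P.e m (initial m s)) Pi := by
  have cont : ∀ ψ ∈ BL₁ Θ, Continuous ψ := fun ψ hψ =>
    (LipschitzWith.of_dist_le_mul (K := 1) fun s t => by
      simpa [Real.dist_eq] using hψ.1 s t).continuous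
  obtain ⟨D, hDc, hDB, hD⟩ : ∃ D : Set (Θ → ℝ), D.Countable ∧ D ⊆ BL₁ Θ ∧ ∀ ψ ∈ BL₁ Θ,
      ∃ u : ℕ → Θ → ℝ, (∀ k, u k ∈ D) ∧ ∀ x, Tendsto (fun k => u k x) atTop (𝓝 (ψ x)) := by
    rcases isEmpty_or_nonempty Θ with h | h
    · exact ⟨BL₁ Θ, Set.to_countable _, subset_rfl, fun ψ hψ =>
        ⟨fun _ => ψ, fun _ => hψ, fun x => (h.false x).elim⟩⟩
    let x := TopologicalSpace.denseSeq Θ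
    let r : (Θ → ℝ) → ℕ → ℝ := fun ψ n => ψ (x n)
    obtain ⟨C, hCs, hCc, hC⟩ :=
      (TopologicalSpace.IsSeparable.of_separableSpace (r '' BL₁ Θ)).exists_countable_dense_subset
    choose! l hl using fun c (hc : c ∈ C) => hCs hc
    refine ⟨l '' C, hCc.image l, by rintro _ ⟨c, hc, rfl⟩; exact (hl c hc).1, fun ψ hψ => ?_⟩
    obtain ⟨c, hcC, hc⟩ := mem_closure_iff_seq_limit.1 (hC ⟨ψ, hψ, rfl⟩)
    refine ⟨fun k => l (c k), fun k => ⟨c k, hcC k, rfl⟩, fun y => ?_⟩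
    rw [Metric.tendsto_atTop]
    intro ε hε
    obtain ⟨n, hn⟩ := (TopologicalSpace.denseRange_denseSeq Θ).exists_dist_lt y
      (show (0 : ℝ) < ε / 3 by positivity)
    have hn' : Tendsto (fun k => l (c k) (x n)) atTop (𝓝 (ψ (x n))) := by
      have := (tendsto_pi_nhds.1 hc) n
      refine this.congr fun k => ?_
      exact (congrFun (hl _ (hcC k)).2 n).symm
    obtain ⟨N, hN⟩ := (Metric.tendsto_atTop.1 hn') (ε / 3) (by positivity)
    refine ⟨N, fun k hk => ?_⟩
    have h1 := (hl _ (hcC k)).1.1 y (x n)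
    have h2 := hψ.1 y (x n)
    have h3 := hN k hk
    have h4 : dist y (x n) < ε / 3 := hn
    rw [Real.dist_eq] at h3 ⊢
    rw [abs_le] at h1 h2
    rw [abs_lt] at h3 ⊢
    constructor <;> linarith [h1.1, h1.2, h2.1, h2.2, h3.1, h3.2]
  have key : (fun s : ℕ → S => blDist (P.e m (initial m s)) Pi) = fun s =>
      ⨆ ψ ∈ D, ENNReal.ofReal |∫ x, ψ x ∂(P.e m (initial m s)) - ∫ x, ψ x ∂Pi| := by
    funext s
    have := P.finite m (initial m s)
    refine le_antisymm (iSup₂_le fun ψ hψ => ?_)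
      (iSup₂_le fun ψ hψ => le_iSup₂_of_le ψ (hDB hψ) le_rfl)
    obtain ⟨u, huD, hu⟩ := hD ψ hψ
    have lim : ∀ μ : Measure Θ, IsFiniteMeasure μ →
        Tendsto (fun k => ∫ x, u k x ∂μ) atTop (𝓝 (∫ x, ψ x ∂μ)) := fun μ _ =>
      tendsto_integral_of_dominated_convergence (fun _ => 1)
        (fun k => (cont _ (hDB (huD k))).aestronglyMeasurable) (integrable_const _)
        (fun k => ae_of_all _ fun x => (hDB (huD k)).2 x) (ae_of_all _ hu)
    refine le_of_tendsto' (ENNReal.tendsto_ofReal ((lim _ this).sub (lim Pi inferInstance)).abs)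
      fun k => ?_
    exact le_iSup₂_of_le (f := fun (ψ : Θ → ℝ) (_ : ψ ∈ D) =>
      ENNReal.ofReal |∫ x, ψ x ∂(P.e m (initial m s)) - ∫ x, ψ x ∂Pi|) (u k) (huD k) le_rfl
  rw [key]
  refine Measurable.biSup D hDc fun ψ hψ => ?_
  have hi : Measurable (initial m : (ℕ → S) → Fin m → S) :=
    measurable_pi_lambda _ fun i => measurable_pi_apply _
  have hm : StronglyMeasurable ψ := (cont ψ (hDB hψ)).stronglyMeasurable
  have hI : Measurable fun s : Fin m → S => ∫ x, ψ x ∂(P.e m s) := by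
    have hs : (fun s : Fin m → S => ∫ x, ψ x ∂(P.e m s)) = fun s =>
        (∫⁻ x, ENNReal.ofReal (ψ x) ∂(P.e m s)).toReal -
          (∫⁻ x, ENNReal.ofReal (-ψ x) ∂(P.e m s)).toReal := by
      funext s
      have := P.finite m s
      exact integral_eq_lintegral_pos_part_sub_lintegral_neg_part
        (Integrable.of_bound hm.aestronglyMeasurable 1 (ae_of_all _ fun x => (hDB hψ).2 x))
    rw [hs]
    exact (hm.measurable.ennreal_ofReal.lintegral_kernel.ennreal_toReal).sub
      (hm.measurable.neg.ennreal_ofReal.lintegral_kernel.ennreal_toReal)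
  exact ((hI.comp hi).sub_const _).abs.ennreal_ofReal

end MonteCarlo

/-! The supremum in `blDist` runs over infinitely many functions, but separability reduces it to
finitely many test integrals. A simple function `F : Θ → Θ` with `F x` close to `x` for most `x`
under `Pi` replaces each `ψ ∈ BL₁` by `ψ ∘ F`. The error is at most the integral of `truncDist F`,
and `∫ ψ ∘ F` depends only on the masses of the finitely many fibres of `F`
(`blDist_le_simpleFunc`). Since `F` depends on `Pi` alone, consistency follows once, for each
bounded measurable `f`, the estimate of `∫ f dPi` converges in `L¹(M)`
(`Procedure.isConsistent_of_tendsto_integral`).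

For independent draws, this convergence is the `L¹` law of large numbers, applied to `f` or to `f`
times the density. For stationary ergodic sequences it is von Neumann's mean ergodic theorem for the
shift. -/

namespace MonteCarlo

/-! ### Integrals of bounded functions -/

section Integrals

variable {Θ : Type*} [MeasurableSpace Θ]

theorem integrable_of_measurable_of_abs_le {f : Θ → ℝ} (hf : Measurable f) {C : ℝ}
    (hC : ∀ x, |f x| ≤ C) (μ : Measure Θ) [IsFiniteMeasure μ] : Integrable f μ :=
  Integrable.of_bound hf.aestronglyMeasurable C (ae_of_all _ hC)

/-- Integrals of `ψ ∘ F` are finite linear combinations of the masses of the fibres of `F`. -/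
theorem integral_comp_simpleFunc (F : SimpleFunc Θ Θ) (ψ : Θ → ℝ) (μ : Measure Θ)
    [IsFiniteMeasure μ] :
    ∫ x, ψ (F x) ∂μ = ∑ y ∈ F.range, ψ y * ∫ x, (F ⁻¹' {y}).indicator 1 x ∂μ := by
  classical
  have h : ∀ x, ψ (F x) = ∑ y ∈ F.range, ψ y * (F ⁻¹' {y}).indicator (1 : Θ → ℝ) x := by
    intro x
    rw [Finset.sum_eq_single (F x)]
    · simp
    · intro y _ hy
      simp [Set.indicator, hy.symm]
    · intro hx
      exact absurd (F.mem_range_self x) hx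
  simp_rw [h]
  rw [integral_finsetSum]
  · simp_rw [integral_const_mul]
  · intro y _
    exact ((integrable_const (1 : ℝ)).indicator (F.measurableSet_fiber y)).const_mul _

/-- This measurability lets the integral of the upper bound for the risk be split term by term. -/
theorem Procedure.measurable_integral_estimator {S : Type*} [MeasurableSpace S] (P : Procedure S Θ)
    (m : ℕ) {f : Θ → ℝ} (hf : Measurable f) {C : ℝ} (hC : ∀ x, |f x| ≤ C) :
    Measurable fun s : ℕ → S => ∫ x, f x ∂(P.e m (initial m s)) := by
  have hi : Measurable (initial m : (ℕ → S) → Fin m → S) :=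
    measurable_pi_lambda _ fun i => measurable_pi_apply _
  have h : (fun s : ℕ → S => ∫ x, f x ∂(P.e m (initial m s))) = fun s =>
      (∫⁻ x, ENNReal.ofReal (f x) ∂(P.e m (initial m s))).toReal -
        (∫⁻ x, ENNReal.ofReal (-f x) ∂(P.e m (initial m s))).toReal := by
    funext s
    have := P.finite m (initial m s)
    exact integral_eq_lintegral_pos_part_sub_lintegral_neg_part
      (integrable_of_measurable_of_abs_le hf hC _)
  rw [h]
  exact (hf.ennreal_ofReal.lintegral_kernel.ennreal_toReal.comp hi).sub
    (hf.neg.ennreal_ofReal.lintegral_kernel.ennreal_toReal.comp hi)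

end Integrals

/-! ### Reduction of the bounded Lipschitz distance to finitely many test functions -/

section Approximation

variable {Θ : Type*} [MetricSpace Θ]

theorem continuous_of_mem_BL₁ {ψ : Θ → ℝ} (hψ : ψ ∈ BL₁ Θ) : Continuous ψ :=
  (LipschitzWith.of_dist_le_mul (K := 1) fun s t => by
    simpa [Real.dist_eq] using hψ.1 s t).continuous

/-- The truncated distance between a point and its image under `F`. -/
noncomputable def truncDist (F : Θ → Θ) (x : Θ) : ℝ := min (dist x (F x)) 2

theorem truncDist_nonneg (F : Θ → Θ) (x : Θ) : 0 ≤ truncDist F x :=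
  le_min dist_nonneg zero_le_two

theorem abs_truncDist_le (F : Θ → Θ) (x : Θ) : |truncDist F x| ≤ 2 := by
  rw [abs_of_nonneg (truncDist_nonneg F x)]
  exact min_le_right _ _

/-- The truncation at 2 costs nothing because `|ψ| ≤ 1`, and it makes the error bound itself a
bounded test function. -/
theorem abs_sub_comp_le_truncDist {ψ : Θ → ℝ} (hψ : ψ ∈ BL₁ Θ) (F : Θ → Θ) (x : Θ) :
    |ψ x - ψ (F x)| ≤ truncDist F x :=
  le_min (hψ.1 _ _) <| (abs_sub _ _).trans (by linarith [hψ.2 x, hψ.2 (F x)])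

variable [MeasurableSpace Θ] [BorelSpace Θ]

theorem measurable_truncDist [TopologicalSpace.SeparableSpace Θ] {F : Θ → Θ}
    (hF : Measurable F) : Measurable (truncDist F) := by
  have := UniformSpace.secondCountable_of_separable Θ
  exact (measurable_id.dist hF).min measurable_const

/-- Triangle inequality through `∫ ψ ∘ F dμ` and `∫ ψ ∘ F dν`. The two replacement errors are `∫
truncDist F` under `μ` and under `ν`; comparing the former with the latter gives the first term and
the factor 2 in the last. No term depends on `ψ`, and the last does not depend on `μ`. -/
theorem blDist_le_simpleFunc [TopologicalSpace.SeparableSpace Θ] (F : SimpleFunc Θ Θ)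
    (μ ν : Measure Θ) [IsFiniteMeasure μ] [IsFiniteMeasure ν] :
    blDist μ ν ≤ ENNReal.ofReal |∫ x, truncDist F x ∂μ - ∫ x, truncDist F x ∂ν| +
      ∑ y ∈ F.range, ENNReal.ofReal
        |∫ x, (F ⁻¹' {y}).indicator 1 x ∂μ - ∫ x, (F ⁻¹' {y}).indicator 1 x ∂ν| +
      ENNReal.ofReal (2 * ∫ x, truncDist F x ∂ν) := by
  refine iSup₂_le fun ψ hψ => ?_
  have hν : 0 ≤ ∫ x, truncDist F x ∂ν := integral_nonneg (truncDist_nonneg F)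
  rw [← ENNReal.ofReal_sum_of_nonneg fun _ _ => abs_nonneg _,
    ← ENNReal.ofReal_add (abs_nonneg _) (Finset.sum_nonneg fun _ _ => abs_nonneg _),
    ← ENNReal.ofReal_add
      (add_nonneg (abs_nonneg _) (Finset.sum_nonneg fun _ _ => abs_nonneg _)) (by positivity)]
  refine ENNReal.ofReal_le_ofReal ?_
  have hψm : Measurable ψ := (continuous_of_mem_BL₁ hψ).measurable
  have approx : ∀ (ρ : Measure Θ) [IsFiniteMeasure ρ],
      |∫ x, ψ x ∂ρ - ∫ x, ψ (F x) ∂ρ| ≤ ∫ x, truncDist F x ∂ρ := by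
    intro ρ _
    rw [← integral_sub (integrable_of_measurable_of_abs_le hψm hψ.2 ρ)
      (integrable_of_measurable_of_abs_le (f := fun x => ψ (F x)) (hψm.comp F.measurable)
        (fun x => hψ.2 (F x)) ρ)]
    refine abs_integral_le_integral_abs.trans (integral_mono_of_nonneg
      (ae_of_all _ fun _ => abs_nonneg _) ?_ (ae_of_all _ (abs_sub_comp_le_truncDist hψ F)))
    exact integrable_of_measurable_of_abs_le (measurable_truncDist F.measurable)
      (abs_truncDist_le F) ρ
  have fibres : |∫ x, ψ (F x) ∂μ - ∫ x, ψ (F x) ∂ν| ≤ ∑ y ∈ F.range,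
      |∫ x, (F ⁻¹' {y}).indicator 1 x ∂μ - ∫ x, (F ⁻¹' {y}).indicator 1 x ∂ν| := by
    rw [integral_comp_simpleFunc, integral_comp_simpleFunc, ← Finset.sum_sub_distrib]
    refine (Finset.abs_sum_le_sum_abs _ _).trans (Finset.sum_le_sum fun y _ => ?_)
    rw [← mul_sub, abs_mul]
    exact mul_le_of_le_one_left (abs_nonneg _) (hψ.2 y)
  have h₁ := abs_le.1 (approx μ)
  have h₂ := abs_le.1 (approx ν)
  have h₃ := abs_le.1 fibres
  have h₄ := le_abs_self (∫ x, truncDist F x ∂μ - ∫ x, truncDist F x ∂ν)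
  rw [abs_le]
  constructor <;> linarith [h₁.1, h₁.2, h₂.1, h₂.2, h₃.1, h₃.2]

/-- A finite measure on a separable metric space is approximated by simple functions. -/
theorem exists_simpleFunc_integral_truncDist_lt [TopologicalSpace.SeparableSpace Θ] [Nonempty Θ]
    (ν : Measure Θ) [IsFiniteMeasure ν] {ε : ℝ} (hε : 0 < ε) :
    ∃ F : SimpleFunc Θ Θ, ∫ x, truncDist F x ∂ν < ε := by
  -- `F n x` is a nearest point to `x` among the first `n + 1` terms of a dense sequence, so `F n x
  -- → x`.
  let F : ℕ → SimpleFunc Θ Θ := SimpleFunc.nearestPt (TopologicalSpace.denseSeq Θ)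
  have hF : ∀ x, Tendsto (fun n => truncDist (F n) x) atTop (𝓝 0) := by
    intro x
    have h := SimpleFunc.tendsto_nearestPt
      (TopologicalSpace.denseRange_denseSeq Θ x)
    have h' := ((tendsto_const_nhds (x := x)).dist h).min (tendsto_const_nhds (x := (2 : ℝ)))
    rw [dist_self x, min_eq_left zero_le_two] at h'
    exact h'
  have h := tendsto_integral_of_dominated_convergence (μ := ν) (fun _ => (2 : ℝ))
    (fun n => (measurable_truncDist (F n).measurable).aestronglyMeasurable)
    (integrable_const _) (fun n => ae_of_all _ (abs_truncDist_le (F n))) (ae_of_all _ hF)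
  rw [integral_zero] at h
  obtain ⟨n, hn⟩ := (h.eventually_lt_const hε).exists
  exact ⟨F n, hn⟩

namespace Procedure

/-- Consistency follows from the mean convergence of the estimates of all bounded integrals. -/
theorem isConsistent_of_tendsto_integral {S : Type*} [MeasurableSpace S]
    [TopologicalSpace.SeparableSpace Θ] (P : Procedure S Θ) (Pi : Measure Θ)
    [IsProbabilityMeasure Pi]
    (h : ∀ f : Θ → ℝ, Measurable f → (∃ C, ∀ x, |f x| ≤ C) → Tendsto (fun m => ∫⁻ s,
      ENNReal.ofReal |∫ x, f x ∂(P.e m (initial m s)) - ∫ x, f x ∂Pi| ∂P.M) atTop (𝓝 0)) :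
    P.IsConsistent Pi := by
  have : Nonempty Θ := Pi.nonempty_of_neZero
  have := P.prob
  rw [IsConsistent, ENNReal.tendsto_nhds_zero]
  intro ε hε
  -- The last term of `blDist_le_simpleFunc` does not vanish as `m → ∞`; the choice of `F` keeps it
  -- below `2 * δ`.
  obtain ⟨δ, hδ0, hδ⟩ : ∃ δ : ℝ, 0 < δ ∧ ENNReal.ofReal (2 * δ) < ε := by
    obtain ⟨r, hr0, hr⟩ := ENNReal.lt_iff_exists_nnreal_btwn.1 hε
    refine ⟨r / 2, by simpa using hr0, ?_⟩
    rwa [mul_div_cancel₀ _ two_ne_zero, ENNReal.ofReal_coe_nnreal]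
  obtain ⟨F, hF⟩ := exists_simpleFunc_integral_truncDist_lt Pi hδ0
  let A : ℕ → (ℕ → S) → ℝ≥0∞ := fun m s => ENNReal.ofReal
    |∫ x, truncDist F x ∂(P.e m (initial m s)) - ∫ x, truncDist F x ∂Pi|
  let B : Θ → ℕ → (ℕ → S) → ℝ≥0∞ := fun y m s => ENNReal.ofReal
    |∫ x, (F ⁻¹' {y}).indicator 1 x ∂(P.e m (initial m s)) -
      ∫ x, (F ⁻¹' {y}).indicator 1 x ∂Pi|
  have hdm := measurable_truncDist F.measurable
  have him : ∀ y, Measurable ((F ⁻¹' {y}).indicator (1 : Θ → ℝ)) := fun y =>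
    measurable_one.indicator (F.measurableSet_fiber y)
  have hib : ∀ y x, |(F ⁻¹' {y}).indicator (1 : Θ → ℝ) x| ≤ 1 := fun y x => by
    by_cases hx : F x = y <;> simp [Set.indicator, hx]
  have hA : ∀ m, Measurable (A m) := fun m =>
    ((P.measurable_integral_estimator m hdm (abs_truncDist_le F)).sub_const _).abs.ennreal_ofReal
  have hB : ∀ y m, Measurable (B y m) := fun y m =>
    ((P.measurable_integral_estimator m (him y) (hib y)).sub_const _).abs.ennreal_ofReal
  -- `F` is now fixed, so this is a finite sum and `h` applies to each term.
  have hlim : Tendsto (fun m => ∫⁻ s, A m s ∂P.M + ∑ y ∈ F.range, ∫⁻ s, B y m s ∂P.M +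
      ENNReal.ofReal (2 * δ)) atTop (𝓝 (0 + ∑ y ∈ F.range, 0 + ENNReal.ofReal (2 * δ))) :=
    ((h _ hdm ⟨2, abs_truncDist_le F⟩).add
      (tendsto_finsetSum _ fun y _ => h _ (him y) ⟨1, hib y⟩)).add tendsto_const_nhds
  rw [Finset.sum_const_zero, zero_add, zero_add] at hlim
  filter_upwards [hlim.eventually_le_const hδ] with m hm
  refine le_trans ?_ hm
  calc P.risk Pi m ≤ ∫⁻ s, (A m s + ∑ y ∈ F.range, B y m s + ENNReal.ofReal (2 * δ)) ∂P.M := by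
        refine lintegral_mono fun s => ?_
        have := P.finite m (initial m s)
        refine (blDist_le_simpleFunc F _ Pi).trans ?_
        gcongr
    _ = _ := by
        rw [lintegral_add_right _ measurable_const, lintegral_add_left (hA m),
          lintegral_finsetSum _ fun y _ => hB y m]
        simp

end Procedure

end Approximation

theorem shift_iterate {Θ : Type*} (n : ℕ) (s : ℕ → Θ) : shift^[n] s 0 = s n := by
  induction n generalizing s with
  | zero => rfl
  | succ n ih => rw [Function.iterate_succ_apply, ih]; rfl

/-! ### Averages of independent draws -/

section Averages

variable {Θ : Type*} [MeasurableSpace Θ]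

theorem integral_weightedEmpirical {g : Θ → ℝ≥0} (hg : Measurable g) (m : ℕ) (s : ℕ → Θ)
    {f : Θ → ℝ} (hf : Measurable f) :
    ∫ x, f x ∂(weightedEmpirical g hg m (initial m s)) =
      (m : ℝ)⁻¹ • ∑ i ∈ Finset.range m, (g (s i) : ℝ) * f (s i) := by
  change ∫ x, f x ∂((m : ℝ≥0)⁻¹ • ∑ i : Fin m, g (s i) • Measure.dirac (s i)) = _
  rw [integral_smul_nnreal_measure, integral_finsetSum_measure, Finset.sum_range, NNReal.smul_def]
  · simp_rw [integral_smul_nnreal_measure, integral_dirac' f _ hf.stronglyMeasurable,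
      NNReal.smul_def, smul_eq_mul]
    simp
  · exact fun i _ => ((integrable_dirac' hf.stronglyMeasurable (by finiteness))).smul_measure
      ENNReal.coe_ne_top

theorem empirical_eq_weightedEmpirical (m : ℕ) :
    (empirical m : Kernel (Fin m → Θ) Θ) = weightedEmpirical 1 measurable_one m := by
  ext1 s
  change (m : ℝ≥0)⁻¹ • ∑ i, Measure.dirac (s i) =
    (m : ℝ≥0)⁻¹ • ∑ i, (1 : ℝ≥0) • Measure.dirac (s i)
  simp

theorem integral_empirical (m : ℕ) (s : ℕ → Θ) {f : Θ → ℝ} (hf : Measurable f) :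
    ∫ x, f x ∂(empirical m (initial m s)) =
      (m : ℝ)⁻¹ • ∑ i ∈ Finset.range m, f (s i) := by
  rw [empirical_eq_weightedEmpirical, integral_weightedEmpirical measurable_one m s hf]
  simp

/-- The strong law in `L¹`, for which pairwise independence of the coordinates is enough.
Integrable, possibly unbounded `φ` are allowed because importance weights need not be bounded. -/
theorem tendsto_lintegral_average_infinitePi (Q : Measure Θ) [IsProbabilityMeasure Q]
    {φ : Θ → ℝ} (hφ : Measurable φ) (hint : Integrable φ Q) :
    Tendsto (fun m : ℕ => ∫⁻ s : ℕ → Θ,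
      ENNReal.ofReal |(m : ℝ)⁻¹ • ∑ i ∈ Finset.range m, φ (s i) - ∫ x, φ x ∂Q|
        ∂(Measure.infinitePi fun _ : ℕ => Q)) atTop (𝓝 0) := by
  have hmp : ∀ i : ℕ, MeasurePreserving (fun s : ℕ → Θ => s i)
      (Measure.infinitePi fun _ : ℕ => Q) Q := fun i =>
    measurePreserving_eval_infinitePi (fun _ : ℕ => Q) i
  have hident : ∀ i : ℕ, IdentDistrib (fun s : ℕ → Θ => φ (s i)) (fun s => φ (s 0))
      (Measure.infinitePi fun _ : ℕ => Q) (Measure.infinitePi fun _ : ℕ => Q) := fun i =>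
    (IdentDistrib.mk (hmp i).measurable.aemeasurable (hmp 0).measurable.aemeasurable
      ((hmp i).map_eq.trans (hmp 0).map_eq.symm)).comp hφ
  have hindep := iIndepFun_infinitePi (P := fun _ : ℕ => Q) (X := fun _ => φ) fun _ => hφ
  have h := strong_law_Lp le_rfl ENNReal.one_ne_top (fun i (s : ℕ → Θ) => φ (s i))
    (memLp_one_iff_integrable.2 ((hmp 0).integrable_comp_of_integrable hint))
    (fun i j hij => hindep.indepFun hij) hident
  have hmean : ∫ s : ℕ → Θ, φ (s 0) ∂(Measure.infinitePi fun _ : ℕ => Q) = ∫ x, φ x ∂Q := by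
    have h' := integral_map (μ := Measure.infinitePi fun _ : ℕ => Q) (hmp 0).measurable.aemeasurable
      hφ.aestronglyMeasurable
    rw [(hmp 0).map_eq] at h'
    exact h'.symm
  rw [hmean] at h
  refine h.congr fun m => ?_
  rw [eLpNorm_one_eq_lintegral_enorm]
  simp_rw [Real.enorm_eq_ofReal_abs]

end Averages

/-! ### The mean ergodic theorem -/

section MeanErgodic

/-- The mean ergodic theorem for a linear isometry of a Hilbert space. -/
theorem exists_tendsto_average_linearIsometry {E : Type*} [NormedAddCommGroup E]
    [InnerProductSpace ℝ E] [CompleteSpace E] (U : E →ₗᵢ[ℝ] E) (x : E) :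
    ∃ p : E, U p = p ∧ (∀ e, U e = e → inner ℝ e (x - p) = 0) ∧
      Tendsto (fun m : ℕ => ‖(m : ℝ)⁻¹ • ∑ i ∈ Finset.range m, U^[i] x - p‖ₑ) atTop (𝓝 0) := by
  -- The fixed space of `U`; the limit `p` is the orthogonal projection of `x` onto it.
  let K := U.toContinuousLinearMap.eqLocus (1 : E →L[ℝ] E)
  have hlim := U.toContinuousLinearMap.tendsto_birkhoffAverage_orthogonalProjection
    U.norm_toContinuousLinearMap_le x
  refine ⟨K.orthogonalProjectionOnto x, (K.orthogonalProjectionOnto x).2, fun e he => ?_, ?_⟩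
  · exact (K.mem_orthogonal _).1 (K.sub_starProjection_mem_orthogonal x) e he
  · have := ENNReal.tendsto_ofReal (tendsto_iff_norm_sub_tendsto_zero.1 hlim)
    rw [ENNReal.ofReal_zero] at this
    exact this.congr fun m => ofReal_norm _

variable {Ω : Type*} [MeasurableSpace Ω] {μ : Measure Ω} [IsProbabilityMeasure μ] {T : Ω → Ω}

/-- The mean ergodic theorem for square-integrable observables of an ergodic transformation. -/
theorem tendsto_lintegral_average_of_ergodic (hT : Ergodic T μ) {φ : Ω → ℝ}
    (hφ : MemLp φ 2 μ) :
    Tendsto (fun m : ℕ => ∫⁻ ω,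
      ENNReal.ofReal |(m : ℝ)⁻¹ • ∑ i ∈ Finset.range m, φ (T^[i] ω) - ∫ x, φ x ∂μ| ∂μ)
      atTop (𝓝 0) := by
  have hTm := hT.toMeasurePreserving
  let x : Lp ℝ 2 μ := hφ.toLp φ
  obtain ⟨p, hpU, hpx, hlim⟩ :=
    exists_tendsto_average_linearIsometry (Lp.compMeasurePreservingₗᵢ ℝ T hTm) x
  set U := Lp.compMeasurePreserving (E := ℝ) (p := 2) T hTm
  -- `U p = p` says that `p ∘ T = p` almost everywhere, so ergodicity makes `p` constant.
  obtain ⟨c, hc⟩ : ∃ c, (p : Ω → ℝ) =ᵐ[μ] Function.const Ω c := by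
    refine hT.ae_eq_const_of_ae_eq_comp_ae (Lp.aestronglyMeasurable _) ?_
    have h : U p = p := hpU
    have h' := Lp.coeFn_compMeasurePreserving p hTm
    rw [h] at h'
    exact h'.symm
  have hc1 : c = ∫ ω, φ ω ∂μ := by
    -- The constant 1 is fixed by `U`, hence orthogonal to `x - p`. This equates the means of `φ`
    -- and `p`, and the latter is `c` because `μ` has mass one.
    let e : Lp ℝ 2 μ := (memLp_const (1 : ℝ)).toLp (fun _ => 1)
    have he : U e = e := Lp.toLp_compMeasurePreserving _ hTm
    have horth : inner ℝ e (x - p) = 0 := hpx e he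
    rw [inner_sub_right, sub_eq_zero, L2.inner_def, L2.inner_def] at horth
    have he' : e =ᵐ[μ] fun _ => (1 : ℝ) := MemLp.coeFn_toLp _
    have hx' : x =ᵐ[μ] φ := MemLp.coeFn_toLp _
    have h₁ : ∫ ω, inner ℝ (e ω) (x ω) ∂μ = ∫ ω, φ ω ∂μ := by
      refine integral_congr_ae ?_
      filter_upwards [he', hx'] with ω h₁ h₂
      simp [h₁, h₂]
    have h₂ : ∫ ω, inner ℝ (e ω) (p ω) ∂μ = ∫ _, c ∂μ := by
      refine integral_congr_ae ?_
      filter_upwards [he', hc] with ω h₁ h₂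
      simp [h₁, h₂]
    rw [h₁, h₂] at horth
    simpa using horth.symm
  have hiter : ∀ i, U^[i] x = (hφ.comp_measurePreserving (hTm.iterate i)).toLp (φ ∘ T^[i]) := by
    intro i
    have h : U^[i] = Lp.compMeasurePreserving T^[i] (hTm.iterate i) :=
      (Lp.compMeasurePreserving_iterate ..)
    rw [h]
    exact Lp.toLp_compMeasurePreserving hφ (hTm.iterate i)
  have hcoe : ∀ m : ℕ, ((m : ℝ)⁻¹ • ∑ i ∈ Finset.range m, U^[i] x - p : Lp ℝ 2 μ) =ᵐ[μ]
      fun ω => (m : ℝ)⁻¹ • ∑ i ∈ Finset.range m, φ (T^[i] ω) - ∫ x, φ x ∂μ := by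
    intro m
    have h₁ : ∀ᵐ ω ∂μ, ∀ i, (U^[i] x : Lp ℝ 2 μ) ω = φ (T^[i] ω) := by
      refine ae_all_iff.2 fun i => ?_
      rw [hiter i]
      exact MemLp.coeFn_toLp _
    have h₂ := Lp.coeFn_finsetSum (Finset.range m) fun i => U^[i] x
    filter_upwards [h₁, h₂, hc,
      Lp.coeFn_sub ((m : ℝ)⁻¹ • ∑ i ∈ Finset.range m, U^[i] x) p,
      Lp.coeFn_smul (m : ℝ)⁻¹ (∑ i ∈ Finset.range m, U^[i] x)] with ω h₁ h₂ h₃ h₄ h₅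
    rw [h₄, Pi.sub_apply, h₃, hc1, h₅, Pi.smul_apply, h₂]
    simp [h₁]
  refine tendsto_of_tendsto_of_tendsto_of_le_of_le tendsto_const_nhds hlim
    (fun _ => zero_le) fun m => ?_
  change _ ≤ ‖(m : ℝ)⁻¹ • ∑ i ∈ Finset.range m, U^[i] x - p‖ₑ
  rw [Lp.enorm_def, ← eLpNorm_congr_ae (hcoe m).symm]
  -- On a probability space the `L¹` norm is at most the `L²` norm.
  refine le_trans (le_of_eq ?_) (eLpNorm_le_eLpNorm_of_exponent_le (p := 1) one_le_two
    ((Lp.aestronglyMeasurable _).congr (hcoe m)))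
  rw [eLpNorm_one_eq_lintegral_enorm]
  simp_rw [Real.enorm_eq_ofReal_abs]

end MeanErgodic

/-! ### Consistency of the three procedures -/

theorem isConsistent_crude {Θ : Type*} [MetricSpace Θ] [TopologicalSpace.SeparableSpace Θ]
    [MeasurableSpace Θ] [BorelSpace Θ] (Pi : Measure Θ) [IsProbabilityMeasure Pi] :
    (crude Pi).IsConsistent Pi := by
  refine (crude Pi).isConsistent_of_tendsto_integral Pi fun f hf ⟨C, hC⟩ => ?_
  refine (tendsto_lintegral_average_infinitePi Pi hf
    (integrable_of_measurable_of_abs_le hf hC Pi)).congr fun m => lintegral_congr fun s => ?_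
  rw [← integral_empirical m s hf]
  rfl

/-- By absolute continuity, `f` times the density is `Q`-integrable with `Q`-mean `∫ f dPi`, so the
law of large numbers under `Q` has the right limit. -/
theorem isConsistent_importance {Θ : Type*} [MetricSpace Θ] [TopologicalSpace.SeparableSpace Θ]
    [MeasurableSpace Θ] [BorelSpace Θ] {Pi Q : Measure Θ} [IsProbabilityMeasure Pi]
    [IsProbabilityMeasure Q] (h : Pi ≪ Q) : (importance Pi Q).IsConsistent Pi := by
  refine (importance Pi Q).isConsistent_of_tendsto_integral Pi fun f hf ⟨C, hC⟩ => ?_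
  have hm := Measure.measurable_rnDeriv Pi Q
  have hint : Integrable (fun x => (Pi.rnDeriv Q x).toReal * f x) Q :=
    (integrable_rnDeriv_smul_iff h).2 (integrable_of_measurable_of_abs_le hf hC Pi)
  have hval : ∫ x, (Pi.rnDeriv Q x).toReal * f x ∂Q = ∫ x, f x ∂Pi := integral_rnDeriv_smul h
  have key := tendsto_lintegral_average_infinitePi Q
    (φ := fun x => (Pi.rnDeriv Q x).toReal * f x) (hm.ennreal_toReal.mul hf) hint
  simp only [hval] at key
  refine key.congr fun m => lintegral_congr fun s => ?_
  -- The weight `toNNReal`, coerced to `ℝ`, is `toReal` by definition.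
  exact congrArg (fun t => ENNReal.ofReal |t - ∫ x, f x ∂Pi|)
    (integral_weightedEmpirical hm.ennreal_toNNReal m s hf).symm

/-- The mean ergodic theorem is applied on sequence space to `s ↦ f (s 0)`. Its value at the `i`-th
shift of `s` is `f (s i)`, and its mean is `∫ f dPi` because `s 0` has law `Pi`. -/
theorem Procedure.isConsistent_of_isErgodic {Θ : Type*} [MetricSpace Θ]
    [TopologicalSpace.SeparableSpace Θ] [MeasurableSpace Θ] [BorelSpace Θ] {Pi : Measure Θ}
    [IsProbabilityMeasure Pi] {P : Procedure Θ Θ} (hs : P.IsStationary) (he : P.IsErgodic)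
    (hlaw : P.invariantLaw = Pi) (hemp : ∀ m, 1 ≤ m → P.e m = empirical m) :
    P.IsConsistent Pi := by
  have := P.prob
  refine P.isConsistent_of_tendsto_integral Pi fun f hf ⟨C, hC⟩ => ?_
  have h0 : Measurable fun s : ℕ → Θ => s 0 := measurable_pi_apply 0
  have hval : ∫ s : ℕ → Θ, f (s 0) ∂P.M = ∫ x, f x ∂Pi := by
    rw [← hlaw, Procedure.invariantLaw, integral_map h0.aemeasurable hf.aestronglyMeasurable]
  have hφ : MemLp (fun s : ℕ → Θ => f (s 0)) 2 P.M :=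
    MemLp.of_bound (hf.comp h0).aestronglyMeasurable C (ae_of_all _ fun s => hC (s 0))
  have key := tendsto_lintegral_average_of_ergodic (T := shift) (Ergodic.mk hs he) hφ
  simp only [hval, shift_iterate] at key
  refine key.congr' ?_
  -- The estimator `P.e 0` is arbitrary, so the two sequences are compared only for `m ≥ 1`.
  filter_upwards [eventually_ge_atTop 1] with m hm
  refine lintegral_congr fun s => ?_
  rw [hemp m hm, integral_empirical m s hf]

end MonteCarlo

theorem mainTheorem7 {Θ : Type*} [MetricSpace Θ] [CompleteSpace Θ]
    [TopologicalSpace.SeparableSpace Θ] [MeasurableSpace Θ] [BorelSpace Θ]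
    (Pi : Measure Θ) [IsProbabilityMeasure Pi] :
    (MonteCarlo.crude Pi).IsConsistent Pi ∧
    (∀ (Q : Measure Θ) [IsProbabilityMeasure Q], Pi ≪ Q →
      (MonteCarlo.importance Pi Q).IsConsistent Pi) ∧
    (∀ P : MonteCarlo.Procedure Θ Θ, P.IsStationary → P.IsErgodic → P.invariantLaw = Pi →
      (∀ m, 1 ≤ m → P.e m = MonteCarlo.empirical m) → P.IsConsistent Pi) :=
  ⟨MonteCarlo.isConsistent_crude Pi, fun _ _ h => MonteCarlo.isConsistent_importance h,
    fun _ hs he hlaw hemp => MonteCarlo.Procedure.isConsistent_of_isErgodic hs he hlaw hemp⟩
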